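/- Consider the single-input linear system $\dot x(t)=Ax(t)+Bu(t)$ with $A\in\mathbb R^{n\times n}$, $B\in\mathbb R^{n\times 1}$, and fix $T>0$. Let $0\le U_1<U_2<\dots<U_N=1$ ($N\ge 1$) and let $w_1,\dots,w_N\ge 0$ be weights with $w_1+\dots+w_N=1$. For measurable $u:[0,T]\to\mathbb R$ put $\|u\|_1=\int_0^T|u(t)|\,dt$, $\|u\|_\infty=\operatorname{ess\,sup}_{t\in[0,T]}|u(t)|$, and $$J(u)=\sum_{i=1}^N w_i\bigl(\|u-U_i\|_1+\|u+U_i\|_1\bigr).$$ For $\xi\in\mathbb R^n$ let $\mathcal U(\xi)$ be the set of measurable controls $u$ on $[0,T]$ with $\|u\|_\infty\le 1$ that steer the system from $x(0)=\xi$ to $x(T)=0$, and let $$\mathcal R=\Bigl\{\int_0^T e^{-At}Bu(t)\,dt:\ u \text{ measurable},\ \|u\|_\infty\le 1\Bigr\}$$ be the reachable set. If the pair $(A,B)$ is controllable, then for every $\xi\in\mathcal R$ the minimum $$V(\xi)=\min\{J(u):u\in\mathcal U(\xi)\}$$ exists, and the value function $V$ is continuous on $\mathcal R$. -/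

import Mathlib

open MeasureTheory Set
open scoped Matrix ENNReal

noncomputable section

/-- `x` is a (Carathéodory) solution on `[0, τ]` of the single-input linear system
`x'(t) = A x(t) + B u(t)` driven by the integrable control `u`: it is continuous and satisfies
the equation in integrated form. -/
def IsTrajectory {n : ℕ} (A : Matrix (Fin n) (Fin n) ℝ) (B : Fin n → ℝ) (τ : ℝ)
    (u : ℝ → ℝ) (x : ℝ → Fin n → ℝ) : Prop :=
  IntervalIntegrable u volume 0 τ ∧ ContinuousOn x (Icc 0 τ) ∧
    ∀ t ∈ Icc 0 τ, x t = x 0 + ∫ s in (0 : ℝ)..t, (A *ᵥ x s + u s • B)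

/-- The pair `(A, B)` is controllable: every state can be steered to every other state in some
finite time by some control. -/
def Controllable {n : ℕ} (A : Matrix (Fin n) (Fin n) ℝ) (B : Fin n → ℝ) : Prop :=
  ∀ x₀ x₁ : Fin n → ℝ, ∃ τ : ℝ, 0 < τ ∧ ∃ (u : ℝ → ℝ) (x : ℝ → Fin n → ℝ),
    IsTrajectory A B τ u x ∧ x 0 = x₀ ∧ x τ = x₁

/-- Measurable controls on `[0, T]` with `‖u‖_∞ ≤ 1`. -/
def admissibleControls (T : ℝ) : Set (ℝ → ℝ) :=
  {u | AEStronglyMeasurable u (volume.restrict (Icc 0 T)) ∧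
    eLpNorm u ∞ (volume.restrict (Icc 0 T)) ≤ 1}

/-- The set `𝒰(ξ)` of feasible controls: those with `‖u‖_∞ ≤ 1` which steer the state from
`x(0) = ξ` to `x(T) = 0`. -/
def feasibleControls {n : ℕ} (A : Matrix (Fin n) (Fin n) ℝ) (B : Fin n → ℝ) (T : ℝ)
    (ξ : Fin n → ℝ) : Set (ℝ → ℝ) :=
  {u | u ∈ admissibleControls T ∧
    ∃ x : ℝ → Fin n → ℝ, IsTrajectory A B T u x ∧ x 0 = ξ ∧ x T = 0}

/-- The reachable set `ℛ = {∫₀ᵀ e^{-At} B u(t) dt : ‖u‖_∞ ≤ 1}`. -/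
def reachableSet {n : ℕ} (A : Matrix (Fin n) (Fin n) ℝ) (B : Fin n → ℝ) (T : ℝ) :
    Set (Fin n → ℝ) :=
  {ξ | ∃ u ∈ admissibleControls T,
    ξ = ∫ t in (0 : ℝ)..T, u t • (NormedSpace.exp (-(t • A)) *ᵥ B)}

/-- The norm `‖v‖₁ = ∫₀ᵀ |v(t)| dt`. -/
def l1Norm (T : ℝ) (v : ℝ → ℝ) : ℝ :=
  ∫ t in (0 : ℝ)..T, |v t|

/-- The sum-of-absolute-values cost `J(u) = ∑ᵢ wᵢ (‖u - Uᵢ‖₁ + ‖u + Uᵢ‖₁)`. -/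
def soavCost {N : ℕ} (U w : Fin N → ℝ) (T : ℝ) (u : ℝ → ℝ) : ℝ :=
  ∑ i, w i * (l1Norm T (fun t => u t - U i) + l1Norm T (fun t => u t + U i))

/-- The optimal value `V(ξ)` of the cost `J` over the feasible controls. -/
def valueFunction {n N : ℕ} (A : Matrix (Fin n) (Fin n) ℝ) (B : Fin n → ℝ)
    (U w : Fin N → ℝ) (T : ℝ) (ξ : Fin n → ℝ) : ℝ :=
  sInf (soavCost U w T '' feasibleControls A B T ξ)

end

/-! Viewed in L²([0, T]), the controls with |u| ≤ 1 form a bounded closed convex set K, the cost J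
is continuous and convex, and by variation of constants u steers ξ to 0 exactly when Φ u = ξ for a
continuous linear map Φ with Φ(K) = ℛ. Minimizers exist by weak compactness, which enters as the
intersection property of decreasing bounded closed convex sets (`exists_feasible_of_approximate`).

V is convex on ℛ, hence continuous in its interior. At any other point of ℛ, a supporting functional
f forces u(t) f(e^{-tA}B) = -|f(e^{-tA}B)| a.e. for every feasible u. By controllability and
analyticity f(e^{-tA}B) ≠ 0 a.e., so |u| = 1 a.e. (`Controllable.ae_abs_eq_one_of_notMem_interior`).

Pointwise |u - Uᵢ| + |u + Uᵢ| = 2 max(|u|, Uᵢ), so J ≤ 2T on K, with equality when |u| = 1 a.e. Thus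
V takes its largest possible value 2T at such points: upper semicontinuity is free, and lower
semicontinuity is again the compactness argument (`continuousOn_value_convexProgram`). -/

/-! ### Compactness of convex sets in Hilbert space -/

/-- In a Hilbert space, a decreasing sequence of nonempty closed convex sets whose first member is
bounded has nonempty intersection. -/
theorem nonempty_iInter_of_antitone_closed_convex {H : Type*} [NormedAddCommGroup H]
    [InnerProductSpace ℝ H] [CompleteSpace H] (C : ℕ → Set H) (hne : ∀ k, (C k).Nonempty)
    (hcl : ∀ k, IsClosed (C k)) (hcv : ∀ k, Convex ℝ (C k)) (hanti : Antitone C)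
    (hbd : Bornology.IsBounded (C 0)) : (⋂ k, C k).Nonempty := by
  have hmin : ∀ k, ∃ v ∈ C k, ∀ w ∈ C k, ‖v‖ ≤ ‖w‖ := by
    intro k
    obtain ⟨v, hv, hvm⟩ :=
      exists_norm_eq_iInf_of_complete_convex (hne k) (hcl k).isComplete (hcv k) 0
    refine ⟨v, hv, fun w hw => ?_⟩
    simp only [zero_sub, norm_neg] at hvm
    rw [hvm]
    exact ciInf_le (f := fun w : C k => ‖(w : H)‖)
      ⟨0, Set.forall_mem_range.2 fun _ => norm_nonneg _⟩ ⟨w, hw⟩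
  choose x hx hxmin using hmin
  obtain ⟨M, hM⟩ := hbd.exists_norm_le
  have hmono : Monotone fun k => ‖x k‖ ^ 2 := fun i j hij =>
    pow_le_pow_left₀ (norm_nonneg _) (hxmin i _ (hanti hij (hx j))) 2
  have hbdd : BddAbove (range fun k => ‖x k‖ ^ 2) := by
    refine ⟨M ^ 2, ?_⟩
    rintro _ ⟨k, rfl⟩
    exact pow_le_pow_left₀ (norm_nonneg _) (hM _ (hanti (Nat.zero_le k) (hx k))) 2
  have hcauchy : CauchySeq fun k => ‖x k‖ ^ 2 := (tendsto_atTop_ciSup hmono hbdd).cauchySeq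
  -- The midpoint of `x i` and `x j` lies in `C i`, so its norm is at least `‖x i‖`. The
  -- parallelogram law then bounds distances by increments of the convergent sequence `‖x k‖ ^ 2`.
  have hdist : ∀ i j, i ≤ j → ‖x j - x i‖ ^ 2 ≤ 2 * (‖x j‖ ^ 2 - ‖x i‖ ^ 2) := by
    intro i j hij
    have hmid : ‖x i‖ ≤ ‖(2⁻¹ : ℝ) • x j + (2⁻¹ : ℝ) • x i‖ :=
      hxmin i _ (hcv i (hanti hij (hx j)) (hx i) (by norm_num) (by norm_num) (by norm_num))
    rw [← smul_add, norm_smul, Real.norm_of_nonneg (by norm_num)] at hmid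
    have hpar := parallelogram_law_with_norm ℝ (x j) (x i)
    nlinarith [norm_nonneg (x i), norm_nonneg (x j + x i)]
  have hx_cauchy : CauchySeq x := by
    rw [Metric.cauchySeq_iff'] at hcauchy ⊢
    intro ε hε
    obtain ⟨k, hk⟩ := hcauchy (ε ^ 2 / 2) (by positivity)
    refine ⟨k, fun j hj => ?_⟩
    have h1 := hk j hj
    rw [Real.dist_eq] at h1
    have h2 := hdist k j hj
    have h3 := le_abs_self (‖x j‖ ^ 2 - ‖x k‖ ^ 2)
    rw [dist_eq_norm]
    exact lt_of_pow_lt_pow_left₀ 2 hε.le (by linarith)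
  obtain ⟨y, hy⟩ := cauchySeq_tendsto_of_complete hx_cauchy
  refine ⟨y, mem_iInter.2 fun k => (hcl k).mem_of_tendsto hy ?_⟩
  filter_upwards [Filter.eventually_ge_atTop k] with j hj using hanti hj (hx j)

/-! ### Convex programs: attainment and continuity of the value -/

section ConvexProgram

variable {H F : Type*} [NormedAddCommGroup H] [InnerProductSpace ℝ H] [CompleteSpace H]
  [NormedAddCommGroup F] [NormedSpace ℝ F]
  {K : Set H} {J : H → ℝ} {Φ : H →L[ℝ] F}

/-- A convex program that is approximately feasible at level `c` is feasible at level `c`. -/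
theorem exists_feasible_of_approximate (hKcl : IsClosed K) (hKcv : Convex ℝ K)
    (hKbd : Bornology.IsBounded K) (hJc : Continuous J) (hJcv : ConvexOn ℝ univ J)
    (c : ℝ) (ξ : F)
    (h : ∀ ε > 0, ∃ u ∈ K, J u ≤ c + ε ∧ ‖Φ u - ξ‖ ≤ ε) :
    ∃ u ∈ K, J u ≤ c ∧ Φ u = ξ := by
  let C : ℕ → Set H := fun k =>
    K ∩ ({u | J u ≤ c + 1 / ((k : ℝ) + 1)} ∩ Φ ⁻¹' Metric.closedBall ξ (1 / ((k : ℝ) + 1)))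
  have hC : (⋂ k, C k).Nonempty := by
    refine nonempty_iInter_of_antitone_closed_convex C ?_ ?_ ?_ ?_ ?_
    · intro k
      obtain ⟨u, hu, hJu, hΦu⟩ := h (1 / ((k : ℝ) + 1)) Nat.one_div_pos_of_nat
      exact ⟨u, hu, hJu, by simpa [dist_eq_norm] using hΦu⟩
    · exact fun k => hKcl.inter ((isClosed_le hJc continuous_const).inter
        (Metric.isClosed_closedBall.preimage Φ.continuous))
    · intro k
      have h1 := hJcv.convex_le (c + 1 / ((k : ℝ) + 1))
      simp only [mem_univ, true_and] at h1
      exact hKcv.inter (h1.inter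
        ((convex_closedBall ξ _).linear_preimage (Φ : H →ₗ[ℝ] F)))
    · intro i j hij u hu
      have hle : 1 / ((j : ℝ) + 1) ≤ 1 / ((i : ℝ) + 1) := Nat.one_div_le_one_div hij
      refine ⟨hu.1, hu.2.1.trans (add_le_add_right hle c), Metric.closedBall_subset_closedBall hle hu.2.2⟩
    · exact hKbd.subset inter_subset_left
  obtain ⟨u, hu⟩ := hC
  rw [mem_iInter] at hu
  have hlim : Filter.Tendsto (fun k : ℕ => 1 / ((k : ℝ) + 1)) Filter.atTop (nhds 0) :=
    tendsto_one_div_add_atTop_nhds_zero_nat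
  refine ⟨u, (hu 0).1, ?_, ?_⟩
  · have := ge_of_tendsto' (hlim.const_add c) fun k => (hu k).2.1
    simpa using this
  · have := ge_of_tendsto' hlim fun k => (hu k).2.2
    exact dist_le_zero.1 this

/-- A convex program over a bounded closed convex subset of a Hilbert space attains its value. -/
theorem isLeast_convexProgram (hKcl : IsClosed K) (hKcv : Convex ℝ K)
    (hKbd : Bornology.IsBounded K) (hJc : Continuous J) (hJcv : ConvexOn ℝ univ J)
    (hJ0 : ∀ u, 0 ≤ J u) {ξ : F} (hξ : ξ ∈ Φ '' K) :
    IsLeast (J '' (K ∩ Φ ⁻¹' {ξ})) (sInf (J '' (K ∩ Φ ⁻¹' {ξ}))) := by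
  have hbdd : BddBelow (J '' (K ∩ Φ ⁻¹' {ξ})) := ⟨0, by rintro _ ⟨u, -, rfl⟩; exact hJ0 u⟩
  have hne : (J '' (K ∩ Φ ⁻¹' {ξ})).Nonempty := by
    obtain ⟨u, hu, rfl⟩ := hξ
    exact ⟨J u, u, ⟨hu, rfl⟩, rfl⟩
  obtain ⟨u, hu, hJu, hΦu⟩ := exists_feasible_of_approximate (Φ := Φ) hKcl hKcv hKbd hJc hJcv
    (sInf (J '' (K ∩ Φ ⁻¹' {ξ}))) ξ (by
      intro ε hε
      obtain ⟨_, ⟨u, ⟨hu, hΦu⟩, rfl⟩, hlt⟩ := exists_lt_of_csInf_lt hne (lt_add_of_pos_right _ hε)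
      exact ⟨u, hu, hlt.le, by rw [mem_singleton_iff.1 hΦu]; simpa using hε.le⟩)
  have hmem : J u ∈ J '' (K ∩ Φ ⁻¹' {ξ}) := ⟨u, ⟨hu, hΦu⟩, rfl⟩
  exact ⟨hJu.antisymm (csInf_le hbdd hmem) ▸ hmem, fun _ h => csInf_le hbdd h⟩

/-- The value function of a convex program is continuous on the set of feasible right-hand sides,
if at the non-interior right-hand sides every feasible point is a maximizer of the cost. -/
theorem continuousOn_value_convexProgram [FiniteDimensional ℝ F]
    (hKcl : IsClosed K) (hKcv : Convex ℝ K)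
    (hKbd : Bornology.IsBounded K) (hJc : Continuous J) (hJcv : ConvexOn ℝ univ J)
    (hJ0 : ∀ u, 0 ≤ J u) (M : ℝ) (hJM : ∀ u ∈ K, J u ≤ M)
    (hbdry : ∀ u ∈ K, Φ u ∉ interior (Φ '' K) → J u = M) :
    ContinuousOn (fun ξ => sInf (J '' (K ∩ Φ ⁻¹' {ξ}))) (Φ '' K) := by
  set V : F → ℝ := fun ξ => sInf (J '' (K ∩ Φ ⁻¹' {ξ})) with hV
  have hleast : ∀ ξ ∈ Φ '' K, IsLeast (J '' (K ∩ Φ ⁻¹' {ξ})) (V ξ) := fun ξ hξ =>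
    isLeast_convexProgram hKcl hKcv hKbd hJc hJcv hJ0 hξ
  have hmin : ∀ ξ ∈ Φ '' K, ∃ u ∈ K, Φ u = ξ ∧ J u = V ξ := fun ξ hξ => by
    obtain ⟨u, ⟨hu, hΦu⟩, hJu⟩ := (hleast ξ hξ).1
    exact ⟨u, hu, hΦu, hJu⟩
  have hRcv : Convex ℝ (Φ '' K) := hKcv.linear_image (Φ : H →ₗ[ℝ] F)
  have hVcv : ConvexOn ℝ (Φ '' K) V := by
    -- A convex combination of minimizers is feasible for the combined right-hand side.
    refine ⟨hRcv, fun ξ hξ ζ hζ a b ha hb hab => ?_⟩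
    obtain ⟨u, hu, rfl, hJu⟩ := hmin ξ hξ
    obtain ⟨v, hv, rfl, hJv⟩ := hmin ζ hζ
    rw [← hJu, ← hJv]
    refine le_trans ?_ (hJcv.2 (mem_univ u) (mem_univ v) ha hb hab)
    exact (hleast _ (hRcv hξ hζ ha hb hab)).2
      ⟨a • u + b • v, ⟨hKcv hu hv ha hb hab, by simp⟩, rfl⟩
  intro ξ hξ
  by_cases hint : ξ ∈ interior (Φ '' K)
  · exact ((hVcv.continuousOn_interior ξ hint).continuousAt
      (isOpen_interior.mem_nhds hint)).continuousWithinAt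
  have hfeas : ∀ u ∈ K, Φ u = ξ → J u = M := fun u hu hΦu => hbdry u hu (hΦu ▸ hint)
  have hVξ : V ξ = M := by
    obtain ⟨u, hu, hΦu, hJu⟩ := hmin ξ hξ
    rw [← hJu, hfeas u hu hΦu]
  have hVM : ∀ ζ ∈ Φ '' K, V ζ ≤ M := fun ζ hζ => by
    obtain ⟨u, hu, -, hJu⟩ := hmin ζ hζ
    exact hJu ▸ hJM u hu
  refine tendsto_order.2 ⟨fun c hc => ?_, fun c hc => ?_⟩
  -- If `V ≤ c` at points arbitrarily near `ξ`, their minimizers are approximately feasible for `ξ`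
  -- at level `c`; an exactly feasible point of cost at most `c < M` results, which is impossible.
  · by_contra hcon
    obtain ⟨u, hu, hJu, hΦu⟩ := exists_feasible_of_approximate (Φ := Φ) hKcl hKcv hKbd hJc hJcv
      c ξ (by
        intro ε hε
        have hfr : ∃ᶠ ζ in nhdsWithin ξ (Φ '' K), ¬ c < V ζ := Filter.not_eventually.1 hcon
        have hev : ∀ᶠ ζ in nhdsWithin ξ (Φ '' K), ζ ∈ Φ '' K ∧ dist ζ ξ < ε :=
          Filter.Eventually.and self_mem_nhdsWithin
            (nhdsWithin_le_nhds (Metric.ball_mem_nhds ξ hε))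
        obtain ⟨ζ, hζc, hζ, hd⟩ := (hfr.and_eventually hev).exists
        obtain ⟨u, hu, rfl, hJu⟩ := hmin ζ hζ
        exact ⟨u, hu, by linarith, by rw [← dist_eq_norm]; exact hd.le⟩)
    have := hfeas u hu hΦu
    have : M ≤ c := this ▸ hJu
    linarith
  · filter_upwards [self_mem_nhdsWithin] with ζ hζ
    have := hVM ζ hζ
    linarith

end ConvexProgram

/-! ### Calculus of the matrix exponential -/

section MatrixExponential

variable {n : ℕ}

theorem hasDerivAt_mulVec {M M' : ℝ → Matrix (Fin n) (Fin n) ℝ} {v v' : ℝ → Fin n → ℝ} {t : ℝ}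
    (hM : ∀ i j, HasDerivAt (fun s => M s i j) (M' t i j) t) (hv : HasDerivAt v (v' t) t) :
    HasDerivAt (fun s => M s *ᵥ v s) (M' t *ᵥ v t + M t *ᵥ v' t) t := by
  rw [hasDerivAt_pi] at hv ⊢
  intro i
  have h := HasDerivAt.fun_sum (u := Finset.univ) fun j _ => (hM i j).mul (hv j)
  simpa [Matrix.mulVec, dotProduct, Finset.sum_add_distrib] using h

section
attribute [local instance] Matrix.linftyOpNormedRing Matrix.linftyOpNormedAlgebra

/-- Working entrywise keeps the auxiliary matrix norm out of the statement. -/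
theorem hasDerivAt_matrix_exp_entry (A : Matrix (Fin n) (Fin n) ℝ) (i j : Fin n) (t : ℝ) :
    HasDerivAt (fun s : ℝ => NormedSpace.exp (s • A) i j) ((NormedSpace.exp (t • A) * A) i j) t :=
  ((Matrix.entryLinearMap ℝ ℝ i j).toContinuousLinearMap.hasFDerivAt.comp_hasDerivAt t
    (hasDerivAt_exp_smul_const (𝕂 := ℝ) A t) :)

theorem analyticOnNhd_matrix_exp_entry (A : Matrix (Fin n) (Fin n) ℝ) (i j : Fin n) :
    AnalyticOnNhd ℝ (fun s : ℝ => NormedSpace.exp (-(s • A)) i j) univ := by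
  intro t _
  have h1 : AnalyticAt ℝ (fun s : ℝ => -(s • A)) t := (analyticAt_id.smul analyticAt_const).neg
  have h2 : AnalyticAt ℝ (fun s : ℝ => NormedSpace.exp (-(s • A))) t :=
    AnalyticAt.fun_comp (f := fun s : ℝ => -(s • A))
      (NormedSpace.exp_analytic (𝕂 := ℝ) (-(t • A))) h1
  exact ((Matrix.entryLinearMap ℝ ℝ i j).toContinuousLinearMap.analyticAt _).fun_comp h2

theorem matrix_exp_mul_exp_neg (A : Matrix (Fin n) (Fin n) ℝ) :
    NormedSpace.exp A * NormedSpace.exp (-A) = 1 := by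
  rw [← Matrix.exp_add_of_commute _ _ (Commute.neg_right (Commute.refl A)), add_neg_cancel,
    NormedSpace.exp_zero]

theorem matrix_exp_mul_comm (A : Matrix (Fin n) (Fin n) ℝ) (t : ℝ) :
    NormedSpace.exp (t • A) * A = A * NormedSpace.exp (t • A) :=
  ((Commute.refl A).smul_left t).exp_left

end

theorem hasDerivAt_exp_mulVec (A : Matrix (Fin n) (Fin n) ℝ) {v : ℝ → Fin n → ℝ}
    {v' : Fin n → ℝ} {t : ℝ} (hv : HasDerivAt v v' t) :
    HasDerivAt (fun s => NormedSpace.exp (s • A) *ᵥ v s)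
      (A *ᵥ (NormedSpace.exp (t • A) *ᵥ v t) + NormedSpace.exp (t • A) *ᵥ v') t := by
  have h := hasDerivAt_mulVec (M' := fun s => NormedSpace.exp (s • A) * A) (v' := fun _ => v')
    (fun i j => hasDerivAt_matrix_exp_entry A i j t) hv
  rwa [matrix_exp_mul_comm, ← Matrix.mulVec_mulVec] at h

theorem hasDerivAt_exp_neg_mulVec (A : Matrix (Fin n) (Fin n) ℝ) {v : ℝ → Fin n → ℝ}
    {v' : Fin n → ℝ} {t : ℝ} (hv : HasDerivAt v v' t) :
    HasDerivAt (fun s => NormedSpace.exp (-(s • A)) *ᵥ v s)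
      (NormedSpace.exp (-(t • A)) *ᵥ (v' - A *ᵥ v t)) t := by
  have h := hasDerivAt_mulVec (M' := fun s => NormedSpace.exp (s • (-A)) * (-A))
    (v' := fun _ => v') (fun i j => hasDerivAt_matrix_exp_entry (-A) i j t) hv
  simp only [smul_neg, mul_neg, Matrix.neg_mulVec] at h
  rw [Matrix.mulVec_sub, Matrix.mulVec_mulVec]
  convert h using 1
  abel

theorem continuous_exp_neg_mulVec (A : Matrix (Fin n) (Fin n) ℝ) {v : ℝ → Fin n → ℝ}
    (hv : Continuous v) : Continuous fun s : ℝ => NormedSpace.exp (-(s • A)) *ᵥ v s := by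
  refine Continuous.matrix_mulVec (continuous_matrix fun i j => ?_) hv
  exact continuousOn_univ.1 (analyticOnNhd_matrix_exp_entry A i j).continuousOn

end MatrixExponential

/-! ### Trajectories and variation of constants -/

section Trajectories

/-- As `u` is only integrable, its primitive is merely absolutely continuous, and integration by
parts is used in that generality. It trades `u` for a continuous primitive, to which the ordinary
fundamental theorem applies. -/
theorem integral_mul_eq_primitive_mul_sub {u g g' : ℝ → ℝ} {a b : ℝ}
    (hu : IntervalIntegrable u volume a b) (hg : ∀ s, HasDerivAt g (g' s) s)
    (hg' : Continuous g') :
    ∫ s in a..b, u s * g s =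
      (∫ s in a..b, u s) * g b - ∫ s in a..b, (∫ r in a..s, u r) * g' s := by
  have hderiv : deriv g = g' := funext fun s => (hg s).deriv
  have hgd : ContDiff ℝ 1 g := by
    rw [contDiff_one_iff_deriv]
    exact ⟨fun s => (hg s).differentiableAt, hderiv ▸ hg'⟩
  have hZ := hu.absolutelyContinuousOnInterval_intervalIntegral (c := a) left_mem_uIcc
  have h := hgd.contDiffOn.absolutelyContinuousOnInterval.integral_mul_deriv_eq_deriv_mul hZ
  have hae : ∫ s in a..b, g s * deriv (fun x => ∫ v in a..x, u v) s = ∫ s in a..b, u s * g s := by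
    refine intervalIntegral.integral_congr_ae ?_
    filter_upwards [hu.ae_hasDerivAt_integral] with s hs hsm
    rw [(hs (uIoc_subset_uIcc hsm) a left_mem_uIcc).deriv, mul_comm]
  rw [hae, hderiv] at h
  rw [h, intervalIntegral.integral_same, mul_zero, sub_zero, mul_comm]
  simp only [mul_comm]

theorem intervalIntegral_pi_apply {n : ℕ} {f : ℝ → Fin n → ℝ} {a b : ℝ}
    (hf : IntervalIntegrable f volume a b) (i : Fin n) :
    (∫ s in a..b, f s) i = ∫ s in a..b, f s i :=
  ((ContinuousLinearMap.proj (R := ℝ) (φ := fun _ : Fin n => ℝ) i).intervalIntegral_comp_comm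
    hf).symm

theorem integral_smul_eq_primitive_smul_sub {n : ℕ} {u : ℝ → ℝ} {g g' : ℝ → Fin n → ℝ} {a b : ℝ}
    (hu : IntervalIntegrable u volume a b) (hg : ∀ s, HasDerivAt g (g' s) s)
    (hg' : Continuous g') :
    ∫ s in a..b, u s • g s =
      (∫ s in a..b, u s) • g b - ∫ s in a..b, (∫ r in a..s, u r) • g' s := by
  have hgc : Continuous g := continuous_iff_continuousAt.2 fun s => (hg s).continuousAt
  have hZ := (hu.absolutelyContinuousOnInterval_intervalIntegral (c := a)
    left_mem_uIcc).continuousOn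
  ext i
  rw [Pi.sub_apply, Pi.smul_apply, intervalIntegral_pi_apply (hu.smul_continuousOn hgc.continuousOn),
    intervalIntegral_pi_apply (f := fun s => (∫ r in a..s, u r) • g' s)
      (hZ.smul hg'.continuousOn).intervalIntegrable]
  exact integral_mul_eq_primitive_mul_sub hu (fun s => hasDerivAt_pi.1 (hg s) i)
    ((continuous_apply i).comp hg')

/-- Clamping time extends a function from [0, τ] to a continuous one on ℝ, whose primitive is
differentiable everywhere, endpoints included. -/
theorem continuous_comp_clamp {E : Type*} [TopologicalSpace E] {f : ℝ → E} {τ : ℝ} (hτ : 0 ≤ τ)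
    (hf : ContinuousOn f (Icc 0 τ)) : Continuous fun s => f (max 0 (min s τ)) :=
  hf.comp_continuous (by fun_prop) fun s => ⟨le_max_left _ _, max_le hτ (min_le_right _ _)⟩

theorem clamp_eq_self {s τ : ℝ} (hs : s ∈ Icc 0 τ) : max 0 (min s τ) = s := by
  rw [min_eq_left hs.2, max_eq_right hs.1]

variable {n : ℕ} {A : Matrix (Fin n) (Fin n) ℝ} {B : Fin n → ℝ}

theorem hasDerivAt_exp_neg_mulVec_const (A : Matrix (Fin n) (Fin n) ℝ) (B : Fin n → ℝ) (t : ℝ) :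
    HasDerivAt (fun s : ℝ => NormedSpace.exp (-(s • A)) *ᵥ B)
      (-(NormedSpace.exp (-(t • A)) *ᵥ (A *ᵥ B))) t := by
  have h := hasDerivAt_exp_neg_mulVec A (hasDerivAt_const t B)
  rwa [zero_sub, Matrix.mulVec_neg] at h

/-- Integration by parts in the variation of constants formula. -/
theorem integral_smul_exp_neg_mulVec {τ : ℝ} {u : ℝ → ℝ} (hu : IntervalIntegrable u volume 0 τ) :
    ∫ s in (0 : ℝ)..τ, u s • (NormedSpace.exp (-(s • A)) *ᵥ B) =
      (∫ s in (0 : ℝ)..τ, u s) • (NormedSpace.exp (-(τ • A)) *ᵥ B) +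
        ∫ s in (0 : ℝ)..τ, (∫ r in (0 : ℝ)..s, u r) •
          (NormedSpace.exp (-(s • A)) *ᵥ (A *ᵥ B)) := by
  rw [integral_smul_eq_primitive_smul_sub hu (hasDerivAt_exp_neg_mulVec_const A B)
    (continuous_exp_neg_mulVec A continuous_const).neg]
  simp only [smul_neg, intervalIntegral.integral_neg, sub_neg_eq_add]

theorem continuous_mulVec_const (A : Matrix (Fin n) (Fin n) ℝ) : Continuous fun v => A *ᵥ v :=
  Continuous.matrix_mulVec continuous_const continuous_id

/-- The variation of constants formula. -/
theorem IsTrajectory.exp_neg_mulVec_eq {τ : ℝ} (hτ : 0 ≤ τ) {u : ℝ → ℝ} {x : ℝ → Fin n → ℝ}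
    (h : IsTrajectory A B τ u x) :
    NormedSpace.exp (-(τ • A)) *ᵥ x τ =
      x 0 + ∫ s in (0 : ℝ)..τ, u s • (NormedSpace.exp (-(s • A)) *ᵥ B) := by
  obtain ⟨hu, hx, hxe⟩ := h
  set y : ℝ → Fin n → ℝ := fun s => x (max 0 (min s τ)) with hy
  have hyc : Continuous y := continuous_comp_clamp hτ hx
  have hyx : ∀ s ∈ Icc 0 τ, y s = x s := fun s hs => by simp only [hy, clamp_eq_self hs]
  have hAy : Continuous fun s => A *ᵥ y s := (continuous_mulVec_const A).comp hyc
  -- With Z the primitive of `u`, p = x - Z B on [0, τ] is C¹ although x need not be. There e^{-sA}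
  -- p has derivative Z e^{-sA} A B, and integration by parts turns Z back into `u`.
  set p : ℝ → Fin n → ℝ := fun t => x 0 + ∫ s in (0 : ℝ)..t, A *ᵥ y s with hp
  have hpd : ∀ t, HasDerivAt p (A *ᵥ y t) t := fun t =>
    (hAy.integral_hasStrictDerivAt 0 t).hasDerivAt.const_add _
  have hpc : Continuous p := continuous_iff_continuousAt.2 fun s => (hpd s).continuousAt
  have hxp : ∀ t ∈ Icc 0 τ, x t = p t + (∫ s in (0 : ℝ)..t, u s) • B := by
    intro t ht
    have hsub : uIcc 0 t ⊆ uIcc 0 τ := by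
      rw [uIcc_of_le ht.1, uIcc_of_le hτ]
      exact Icc_subset_Icc_right ht.2
    have hut : IntervalIntegrable u volume 0 t := hu.mono_set hsub
    have hcongr : ∫ s in (0 : ℝ)..t, (A *ᵥ x s + u s • B) =
        ∫ s in (0 : ℝ)..t, (A *ᵥ y s + u s • B) := by
      refine intervalIntegral.integral_congr fun s hs => ?_
      rw [uIcc_of_le ht.1] at hs
      simp only [hyx s ⟨hs.1, hs.2.trans ht.2⟩]
    rw [hxe t ht, hcongr, intervalIntegral.integral_add (hAy.intervalIntegrable 0 t)
      (hut.smul_continuousOn continuousOn_const), intervalIntegral.integral_smul_const, add_assoc]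
  have hq : ∀ t ∈ uIcc 0 τ, HasDerivAt (fun s => NormedSpace.exp (-(s • A)) *ᵥ p s)
      (NormedSpace.exp (-(t • A)) *ᵥ (A *ᵥ y t - A *ᵥ p t)) t := fun t _ =>
    hasDerivAt_exp_neg_mulVec A (hpd t)
  have hFTC := intervalIntegral.integral_eq_sub_of_hasDerivAt hq
    ((continuous_exp_neg_mulVec A
      (hAy.sub ((continuous_mulVec_const A).comp hpc))).intervalIntegrable 0 τ)
  have hcongr : ∫ s in (0 : ℝ)..τ, NormedSpace.exp (-(s • A)) *ᵥ (A *ᵥ y s - A *ᵥ p s) =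
      ∫ s in (0 : ℝ)..τ, (∫ r in (0 : ℝ)..s, u r) •
          (NormedSpace.exp (-(s • A)) *ᵥ (A *ᵥ B)) := by
    refine intervalIntegral.integral_congr fun s hs => ?_
    rw [uIcc_of_le hτ] at hs
    simp only [hyx s hs, hxp s hs, ← Matrix.mulVec_sub, add_sub_cancel_left, Matrix.mulVec_smul]
  have hp0 : p 0 = x 0 := by simp [hp]
  rw [integral_smul_exp_neg_mulVec hu, ← hcongr, hFTC, hp0, hxp τ ⟨hτ, le_rfl⟩, Matrix.mulVec_add,
    Matrix.mulVec_smul]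
  simp only [zero_smul, neg_zero, NormedSpace.exp_zero, Matrix.one_mulVec]
  abel

/-- Every integrable control has a trajectory from every initial state. -/
theorem exists_isTrajectory (A : Matrix (Fin n) (Fin n) ℝ) (B : Fin n → ℝ) {τ : ℝ} (hτ : 0 ≤ τ)
    {u : ℝ → ℝ} (hu : IntervalIntegrable u volume 0 τ) (ξ : Fin n → ℝ) :
    ∃ x : ℝ → Fin n → ℝ, IsTrajectory A B τ u x ∧ x 0 = ξ := by
  have hZc : ContinuousOn (fun t => ∫ s in (0 : ℝ)..t, u s) (Icc 0 τ) := by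
    have h := (hu.absolutelyContinuousOnInterval_intervalIntegral (c := 0)
      left_mem_uIcc).continuousOn
    rwa [uIcc_of_le hτ] at h
  set Z : ℝ → ℝ := fun t => ∫ s in (0 : ℝ)..max 0 (min t τ), u s with hZ
  have hZcont : Continuous Z := continuous_comp_clamp hτ hZc
  have hZeq : ∀ t ∈ Icc 0 τ, Z t = ∫ s in (0 : ℝ)..t, u s := fun t ht => by
    simp only [hZ, clamp_eq_self ht]
  set f : ℝ → Fin n → ℝ := fun s => NormedSpace.exp (-(s • A)) *ᵥ (Z s • (A *ᵥ B)) with hf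
  have hfc : Continuous f := continuous_exp_neg_mulVec A (hZcont.smul continuous_const)
  -- Again p stands for x - Z B: it solves p' = A p + Z A B, an equation with continuous forcing.
  set p : ℝ → Fin n → ℝ := fun t => NormedSpace.exp (t • A) *ᵥ (ξ + ∫ s in (0 : ℝ)..t, f s) with hp
  have hpd : ∀ t, HasDerivAt p (A *ᵥ (p t + Z t • B)) t := by
    intro t
    have h := hasDerivAt_exp_mulVec A
      ((hfc.integral_hasStrictDerivAt 0 t).hasDerivAt.const_add ξ)
    convert h using 1
    simp only [hf, Matrix.mulVec_mulVec _ (NormedSpace.exp (t • A)), matrix_exp_mul_exp_neg,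
      Matrix.one_mulVec, Matrix.mulVec_add, Matrix.mulVec_smul, hp]
  have hpc : Continuous p := continuous_iff_continuousAt.2 fun s => (hpd s).continuousAt
  have hp0 : p 0 = ξ := by simp [hp]
  set x : ℝ → Fin n → ℝ := fun t => p t + Z t • B with hx
  have hxc : Continuous x := hpc.add (hZcont.smul continuous_const)
  have hAx : Continuous fun s => A *ᵥ x s := (continuous_mulVec_const A).comp hxc
  have hx0 : x 0 = ξ := by simp [hx, hp0, hZ, hτ]
  refine ⟨x, ⟨hu, hxc.continuousOn, fun t ht => ?_⟩, hx0⟩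
  have hut : IntervalIntegrable u volume 0 t := by
    refine hu.mono_set ?_
    rw [uIcc_of_le ht.1, uIcc_of_le hτ]
    exact Icc_subset_Icc_right ht.2
  rw [intervalIntegral.integral_add (hAx.intervalIntegrable 0 t)
    (hut.smul_continuousOn continuousOn_const), intervalIntegral.integral_smul_const,
    intervalIntegral.integral_eq_sub_of_hasDerivAt (fun s _ => hpd s) (hAx.intervalIntegrable 0 t),
    hp0, hx0, ← hZeq t ht]
  simp only [hx]
  abel

theorem exp_neg_mulVec_eq_zero_iff (A : Matrix (Fin n) (Fin n) ℝ) (v : Fin n → ℝ) :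
    NormedSpace.exp (-A) *ᵥ v = 0 ↔ v = 0 := by
  refine ⟨fun h => ?_, fun h => by rw [h, Matrix.mulVec_zero]⟩
  rw [← Matrix.one_mulVec v, ← matrix_exp_mul_exp_neg A, ← Matrix.mulVec_mulVec, h,
    Matrix.mulVec_zero]

/-- An integrable control steers `ξ` to the origin iff `ξ + ∫ e^{-sA} B u(s) ds = 0`. -/
theorem exists_isTrajectory_to_zero_iff {τ : ℝ} (hτ : 0 ≤ τ) {u : ℝ → ℝ}
    (hu : IntervalIntegrable u volume 0 τ) (ξ : Fin n → ℝ) :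
    (∃ x : ℝ → Fin n → ℝ, IsTrajectory A B τ u x ∧ x 0 = ξ ∧ x τ = 0) ↔
      ξ + ∫ s in (0 : ℝ)..τ, u s • (NormedSpace.exp (-(s • A)) *ᵥ B) = 0 := by
  constructor
  · rintro ⟨x, hx, rfl, hxτ⟩
    rw [← hx.exp_neg_mulVec_eq hτ, hxτ, Matrix.mulVec_zero]
  · intro h
    obtain ⟨x, hx, rfl⟩ := exists_isTrajectory A B hτ hu ξ
    rw [← hx.exp_neg_mulVec_eq hτ, exp_neg_mulVec_eq_zero_iff] at h
    exact ⟨x, hx, rfl, h⟩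

end Trajectories

/-! ### Controls as elements of L² -/

/-- Lebesgue measure on the control horizon `[0, T]`. -/
noncomputable abbrev horizonMeasure (T : ℝ) : Measure ℝ := volume.restrict (Icc 0 T)

/-- The Hilbert space `L²([0, T])` of controls. -/
abbrev ControlSpace (T : ℝ) : Type := Lp ℝ 2 (horizonMeasure T)

/-- The controls in `L²([0, T])` bounded by `1`. -/
def boundedControls (T : ℝ) : Set (ControlSpace T) :=
  {u | ∀ᵐ t ∂horizonMeasure T, |u t| ≤ 1}

section ControlSpace

variable {T : ℝ}

theorem intervalIntegral_eq_integral_horizon {E : Type*} [NormedAddCommGroup E] [NormedSpace ℝ E]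
    (hT : 0 ≤ T) (f : ℝ → E) : ∫ t in (0 : ℝ)..T, f t = ∫ t, f t ∂horizonMeasure T := by
  rw [intervalIntegral.integral_of_le hT, integral_Icc_eq_integral_Ioc]

/-- Order intervals of the Banach lattice L² are closed. -/
theorem boundedControls_eq_Icc (T : ℝ) :
    boundedControls T = Icc (-Lp.const 2 (horizonMeasure T) 1) (Lp.const 2 (horizonMeasure T) 1) := by
  ext u
  rw [mem_Icc, ← Lp.coeFn_le, ← Lp.coeFn_le, Filter.EventuallyLE, Filter.EventuallyLE,
    ← Filter.eventually_and]
  change (∀ᵐ t ∂horizonMeasure T, |u t| ≤ 1) ↔ _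
  refine Filter.eventually_congr ?_
  filter_upwards [Lp.coeFn_const (μ := horizonMeasure T) (p := 2) (1 : ℝ),
    Lp.coeFn_neg (Lp.const 2 (horizonMeasure T) (1 : ℝ))] with t h1 h2
  rw [h2, Pi.neg_apply, h1, abs_le, Function.const_apply]

theorem isClosed_boundedControls (T : ℝ) : IsClosed (boundedControls T) := by
  rw [boundedControls_eq_Icc]
  exact isClosed_Icc

theorem convex_boundedControls (T : ℝ) : Convex ℝ (boundedControls T) := by
  intro u hu v hv a b ha hb hab
  filter_upwards [hu, hv, Lp.coeFn_add (a • u) (b • v), Lp.coeFn_smul a u, Lp.coeFn_smul b v]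
    with t h1 h2 h3 h4 h5
  rw [h3, Pi.add_apply, h4, h5, Pi.smul_apply, Pi.smul_apply, smul_eq_mul, smul_eq_mul]
  rw [abs_le] at *
  constructor <;> nlinarith

theorem isBounded_boundedControls (T : ℝ) : Bornology.IsBounded (boundedControls T) := by
  refine isBounded_iff_forall_norm_le.2 ⟨‖Lp.const 2 (horizonMeasure T) (1 : ℝ)‖, fun u hu => ?_⟩
  refine Lp.norm_le_norm_of_ae_le ?_
  filter_upwards [hu, Lp.coeFn_const (μ := horizonMeasure T) (p := 2) (1 : ℝ)] with t h1 h2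
  rw [h2]
  simpa using h1

theorem ae_abs_le_one_of_mem_admissibleControls {u : ℝ → ℝ} (hu : u ∈ admissibleControls T) :
    ∀ᵐ t ∂horizonMeasure T, |u t| ≤ 1 := by
  have h := hu.2
  rw [eLpNorm_exponent_top] at h
  filter_upwards [ae_le_eLpNormEssSup (f := u) (μ := horizonMeasure T)] with t ht
  have h2 := ht.trans h
  rwa [← ofReal_norm, ENNReal.ofReal_le_one] at h2

theorem mem_admissibleControls_of_ae_abs_le_one {u : ℝ → ℝ}
    (hm : AEStronglyMeasurable u (horizonMeasure T)) (hu : ∀ᵐ t ∂horizonMeasure T, |u t| ≤ 1) :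
    u ∈ admissibleControls T := by
  refine ⟨hm, ?_⟩
  rw [eLpNorm_exponent_top]
  simpa using eLpNormEssSup_le_of_ae_bound (C := 1) hu

theorem memLp_of_mem_admissibleControls {u : ℝ → ℝ} (hu : u ∈ admissibleControls T) (p : ℝ≥0∞) :
    MemLp u p (horizonMeasure T) :=
  MemLp.of_bound hu.1 1 (ae_abs_le_one_of_mem_admissibleControls hu)

theorem toLp_mem_boundedControls {u : ℝ → ℝ} (hu : u ∈ admissibleControls T) :
    (memLp_of_mem_admissibleControls hu 2).toLp u ∈ boundedControls T := by
  filter_upwards [ae_abs_le_one_of_mem_admissibleControls hu,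
    (memLp_of_mem_admissibleControls hu 2).coeFn_toLp] with t h1 h2
  rwa [h2]

theorem coeFn_mem_admissibleControls {u : ControlSpace T} (hu : u ∈ boundedControls T) :
    ⇑u ∈ admissibleControls T :=
  mem_admissibleControls_of_ae_abs_le_one (Lp.aestronglyMeasurable u) hu

theorem intervalIntegrable_of_mem_admissibleControls (hT : 0 ≤ T) {u : ℝ → ℝ}
    (hu : u ∈ admissibleControls T) : IntervalIntegrable u volume 0 T := by
  rw [intervalIntegrable_iff_integrableOn_Icc_of_le hT]
  exact (memLp_of_mem_admissibleControls hu 1).integrable le_rfl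

theorem neg_mem_admissibleControls {u : ℝ → ℝ} (hu : u ∈ admissibleControls T) :
    (fun t => -u t) ∈ admissibleControls T :=
  mem_admissibleControls_of_ae_abs_le_one hu.1.neg <| by
    simpa only [abs_neg] using ae_abs_le_one_of_mem_admissibleControls hu

end ControlSpace

/-! ### The cost functional -/

section Cost

variable {T : ℝ}

theorem integrable_coeFn (u : ControlSpace T) : Integrable u (horizonMeasure T) :=
  (Lp.memLp u).integrable one_le_two

theorem integrable_abs_add (u : ControlSpace T) (c : ℝ) :
    Integrable (fun t => |u t + c|) (horizonMeasure T) :=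
  ((integrable_coeFn u).add (integrable_const c)).abs

theorem l1Norm_congr (hT : 0 ≤ T) {v w : ℝ → ℝ} (h : v =ᵐ[horizonMeasure T] w) :
    l1Norm T v = l1Norm T w := by
  simp only [l1Norm, intervalIntegral_eq_integral_horizon hT]
  exact integral_congr_ae (h.fun_comp abs)

theorem l1Norm_nonneg (hT : 0 ≤ T) (v : ℝ → ℝ) : 0 ≤ l1Norm T v :=
  intervalIntegral.integral_nonneg hT fun _ _ => abs_nonneg _

theorem continuous_l1Norm_add_const (hT : 0 ≤ T) (c : ℝ) :
    Continuous fun u : ControlSpace T => l1Norm T fun t => u t + c := by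
  -- The L¹ norm is the inner product of the constant 1 with the lattice absolute value, and both
  -- operations are continuous.
  have h : (fun u : ControlSpace T => l1Norm T fun t => u t + c) = fun u =>
      inner ℝ (Lp.const 2 (horizonMeasure T) (1 : ℝ))
        ((u + Lp.const 2 (horizonMeasure T) c) ⊔ -(u + Lp.const 2 (horizonMeasure T) c)) := by
    ext u
    rw [l1Norm, intervalIntegral_eq_integral_horizon hT, L2.inner_def]
    refine integral_congr_ae ?_
    filter_upwards [Lp.coeFn_const (μ := horizonMeasure T) (p := 2) (1 : ℝ),
      Lp.coeFn_const (μ := horizonMeasure T) (p := 2) c,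
      Lp.coeFn_sup (u + Lp.const 2 (horizonMeasure T) c) (-(u + Lp.const 2 (horizonMeasure T) c)),
      Lp.coeFn_neg (u + Lp.const 2 (horizonMeasure T) c),
      Lp.coeFn_add u (Lp.const 2 (horizonMeasure T) c)] with t h1 h2 h3 h4 h5
    rw [h1, h3, Pi.sup_apply, h4, Pi.neg_apply, h5, Pi.add_apply, h2]
    simp [abs]
  have hadd : Continuous fun u : ControlSpace T => u + Lp.const 2 (horizonMeasure T) c :=
    continuous_id.add continuous_const
  rw [h]
  exact continuous_const.inner (hadd.sup hadd.neg)

theorem convexOn_l1Norm_add_const (hT : 0 ≤ T) (c : ℝ) :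
    ConvexOn ℝ univ fun u : ControlSpace T => l1Norm T fun t => u t + c := by
  refine ⟨convex_univ, fun u _ v _ a b ha hb hab => ?_⟩
  simp only [l1Norm, intervalIntegral_eq_integral_horizon hT, smul_eq_mul]
  rw [← integral_const_mul, ← integral_const_mul, ← integral_add
    ((integrable_abs_add u c).const_mul a) ((integrable_abs_add v c).const_mul b)]
  refine integral_mono_ae (integrable_abs_add _ c)
    (((integrable_abs_add u c).const_mul a).add ((integrable_abs_add v c).const_mul b)) ?_
  filter_upwards [Lp.coeFn_add (a • u) (b • v), Lp.coeFn_smul a u, Lp.coeFn_smul b v]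
    with t h3 h4 h5
  rw [h3, Pi.add_apply, h4, h5, Pi.smul_apply, Pi.smul_apply, smul_eq_mul, smul_eq_mul]
  calc |a * u t + b * v t + c| = |a * (u t + c) + b * (v t + c)| := by
        congr 1
        linear_combination (-c) * hab
    _ ≤ |a * (u t + c)| + |b * (v t + c)| := abs_add_le _ _
    _ = a * |u t + c| + b * |v t + c| := by rw [abs_mul, abs_mul, abs_of_nonneg ha, abs_of_nonneg hb]

variable {N : ℕ} {U w : Fin N → ℝ}

theorem soavCost_congr (hT : 0 ≤ T) {u v : ℝ → ℝ} (h : u =ᵐ[horizonMeasure T] v) :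
    soavCost U w T u = soavCost U w T v := by
  refine Finset.sum_congr rfl fun i _ => ?_
  congr 2
  · exact l1Norm_congr hT (h.fun_comp (· - U i))
  · exact l1Norm_congr hT (h.fun_comp (· + U i))

theorem soavCost_nonneg (hT : 0 ≤ T) (hw : ∀ i, 0 ≤ w i) (u : ℝ → ℝ) : 0 ≤ soavCost U w T u :=
  Finset.sum_nonneg fun i _ => mul_nonneg (hw i)
    (add_nonneg (l1Norm_nonneg hT _) (l1Norm_nonneg hT _))

theorem continuous_soavCost (hT : 0 ≤ T) :
    Continuous fun u : ControlSpace T => soavCost U w T u := by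
  unfold soavCost
  simp only [sub_eq_add_neg]
  exact continuous_finsetSum _ fun i _ => continuous_const.mul
    ((continuous_l1Norm_add_const hT _).add (continuous_l1Norm_add_const hT _))

theorem convexOn_soavCost (hT : 0 ≤ T) (hw : ∀ i, 0 ≤ w i) :
    ConvexOn ℝ univ fun u : ControlSpace T => soavCost U w T u := by
  have hi : ∀ i, ConvexOn ℝ univ fun u : ControlSpace T =>
      w i * (l1Norm T (fun t => u t - U i) + l1Norm T (fun t => u t + U i)) := fun i => by
    simp only [sub_eq_add_neg]
    exact ((convexOn_l1Norm_add_const hT _).add (convexOn_l1Norm_add_const hT _)).smul (hw i)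
  refine ⟨convex_univ, fun u hu v hv a b ha hb hab => ?_⟩
  simp only [soavCost, Finset.smul_sum, ← Finset.sum_add_distrib]
  exact Finset.sum_le_sum fun i _ => (hi i).2 hu hv ha hb hab

theorem l1Norm_sub_add_l1Norm_add (hT : 0 ≤ T) (u : ControlSpace T) (c : ℝ) :
    l1Norm T (fun t => u t - c) + l1Norm T (fun t => u t + c) =
      ∫ t, |u t - c| + |u t + c| ∂horizonMeasure T := by
  simp only [l1Norm, intervalIntegral_eq_integral_horizon hT]
  refine (integral_add ?_ (integrable_abs_add u c)).symm
  simpa only [sub_eq_add_neg] using integrable_abs_add u (-c)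

theorem integral_horizon_const (hT : 0 ≤ T) (c : ℝ) : ∫ _, c ∂horizonMeasure T = T * c := by
  rw [← intervalIntegral_eq_integral_horizon hT, intervalIntegral.integral_const, sub_zero,
    smul_eq_mul]

/-- The integrand is 2 max(|u|, Uᵢ) ≤ 2, and the weights sum to 1. -/
theorem soavCost_le (hT : 0 ≤ T) (hw : ∀ i, 0 ≤ w i) (hw_sum : ∑ i, w i = 1)
    (hU : ∀ i, U i ∈ Icc (0 : ℝ) 1) {u : ControlSpace T} (hu : u ∈ boundedControls T) :
    soavCost U w T u ≤ T * 2 := by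
  calc soavCost U w T u ≤ ∑ i, w i * (T * 2) := by
        refine Finset.sum_le_sum fun i _ => mul_le_mul_of_nonneg_left ?_ (hw i)
        rw [l1Norm_sub_add_l1Norm_add hT, ← integral_horizon_const hT]
        refine integral_mono_ae ?_ (integrable_const _) ?_
        · simp only [sub_eq_add_neg]
          exact (integrable_abs_add u (-U i)).add (integrable_abs_add u (U i))
        · filter_upwards [hu] with t ht
          rw [abs_le] at ht
          obtain ⟨h0, h1⟩ := hU i
          rcases abs_cases (u t - U i) with ⟨e1, _⟩ | ⟨e1, _⟩ <;>
          rcases abs_cases (u t + U i) with ⟨e2, _⟩ | ⟨e2, _⟩ <;> rw [e1, e2] <;> linarith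
    _ = T * 2 := by rw [← Finset.sum_mul, hw_sum, one_mul]

theorem soavCost_eq_of_ae_abs_eq_one (hT : 0 ≤ T) (hw_sum : ∑ i, w i = 1)
    (hU : ∀ i, U i ∈ Icc (0 : ℝ) 1) {u : ControlSpace T}
    (hu : ∀ᵐ t ∂horizonMeasure T, |u t| = 1) : soavCost U w T u = T * 2 := by
  calc soavCost U w T u = ∑ i, w i * (T * 2) := by
        refine Finset.sum_congr rfl fun i _ => ?_
        rw [l1Norm_sub_add_l1Norm_add hT, ← integral_horizon_const hT]
        congr 1
        refine integral_congr_ae ?_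
        filter_upwards [hu] with t ht
        obtain ⟨h0, h1⟩ := hU i
        rcases (abs_eq zero_le_one).1 ht with e | e <;> rw [e]
        · rw [abs_of_nonneg (by linarith), abs_of_nonneg (by linarith)]
          ring
        · rw [abs_of_nonpos (by linarith), abs_of_nonpos (by linarith)]
          ring
    _ = T * 2 := by rw [← Finset.sum_mul, hw_sum, one_mul]

end Cost

/-! ### The steering map and the reduction to a convex program -/

section SteeringMap

variable {n : ℕ}

theorem memLp_exp_neg_mulVec_apply (A : Matrix (Fin n) (Fin n) ℝ) (B : Fin n → ℝ) (T : ℝ)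
    (i : Fin n) :
    MemLp (fun t : ℝ => (NormedSpace.exp (-(t • A)) *ᵥ B) i) 2 (horizonMeasure T) := by
  have hc : Continuous fun t : ℝ => (NormedSpace.exp (-(t • A)) *ᵥ B) i :=
    (continuous_apply i).comp (continuous_exp_neg_mulVec A continuous_const)
  obtain ⟨C, hC⟩ := isCompact_Icc.exists_bound_of_continuousOn (s := Icc 0 T) hc.continuousOn
  exact MemLp.of_bound hc.aestronglyMeasurable C
    ((ae_restrict_iff' measurableSet_Icc).2 (Filter.Eventually.of_forall hC))

/-- The map `u ↦ -∫₀ᵀ e^{-tA} B u(t) dt` taking a control to the state which it steers to `0`. -/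
noncomputable def steeringMap (A : Matrix (Fin n) (Fin n) ℝ) (B : Fin n → ℝ) (T : ℝ) :
    ControlSpace T →L[ℝ] (Fin n → ℝ) :=
  ContinuousLinearMap.pi fun i => -innerSL ℝ ((memLp_exp_neg_mulVec_apply A B T i).toLp _)

variable {A : Matrix (Fin n) (Fin n) ℝ} {B : Fin n → ℝ} {T : ℝ}

theorem integrable_smul_exp_neg_mulVec (A : Matrix (Fin n) (Fin n) ℝ) (B : Fin n → ℝ)
    (u : ControlSpace T) :
    Integrable (fun t => u t • (NormedSpace.exp (-(t • A)) *ᵥ B)) (horizonMeasure T) :=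
  Integrable.of_eval fun i => (Lp.memLp u).integrable_mul (memLp_exp_neg_mulVec_apply A B T i)

theorem steeringMap_apply (A : Matrix (Fin n) (Fin n) ℝ) (B : Fin n → ℝ) (u : ControlSpace T) :
    steeringMap A B T u =
      -∫ t, u t • (NormedSpace.exp (-(t • A)) *ᵥ B) ∂horizonMeasure T := by
  ext i
  rw [Pi.neg_apply, eval_integral (f := fun t => u t • (NormedSpace.exp (-(t • A)) *ᵥ B))
    (fun i => (integrable_smul_exp_neg_mulVec A B u).eval i)]
  simp only [steeringMap, ContinuousLinearMap.coe_pi', _root_.neg_apply,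
    innerSL_apply_apply, L2.inner_def]
  congr 1
  refine integral_congr_ae ?_
  filter_upwards [(memLp_exp_neg_mulVec_apply A B T i).coeFn_toLp] with t ht
  rw [ht]
  simp

theorem apply_steeringMap (A : Matrix (Fin n) (Fin n) ℝ) (B : Fin n → ℝ) (u : ControlSpace T)
    (f : (Fin n → ℝ) →L[ℝ] ℝ) :
    f (steeringMap A B T u) =
      -∫ t, u t * f (NormedSpace.exp (-(t • A)) *ᵥ B) ∂horizonMeasure T := by
  rw [steeringMap_apply, map_neg, ← f.integral_comp_comm (integrable_smul_exp_neg_mulVec A B u)]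
  simp only [map_smul, smul_eq_mul]

theorem steeringMap_toLp (hT : 0 ≤ T) {u : ℝ → ℝ} (hu : u ∈ admissibleControls T) :
    steeringMap A B T ((memLp_of_mem_admissibleControls hu 2).toLp u) =
      -∫ t in (0 : ℝ)..T, u t • (NormedSpace.exp (-(t • A)) *ᵥ B) := by
  rw [steeringMap_apply, intervalIntegral_eq_integral_horizon hT]
  congr 1
  refine integral_congr_ae ?_
  filter_upwards [(memLp_of_mem_admissibleControls hu 2).coeFn_toLp] with t ht
  rw [ht]

/-- The sign in the steering map is absorbed by u ↦ -u, a symmetry of the admissible controls. -/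
theorem reachableSet_eq_image (hT : 0 ≤ T) :
    reachableSet A B T = steeringMap A B T '' boundedControls T := by
  ext ξ
  constructor
  · rintro ⟨u, hu, rfl⟩
    refine ⟨_, toLp_mem_boundedControls (neg_mem_admissibleControls hu), ?_⟩
    rw [steeringMap_toLp hT (neg_mem_admissibleControls hu)]
    simp only [neg_smul, intervalIntegral.integral_neg, neg_neg]
  · rintro ⟨u, hu, rfl⟩
    refine ⟨_, neg_mem_admissibleControls (coeFn_mem_admissibleControls hu), ?_⟩
    rw [steeringMap_apply, intervalIntegral_eq_integral_horizon hT]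
    simp only [neg_smul, integral_neg]

theorem mem_feasibleControls_iff (hT : 0 ≤ T) {u : ℝ → ℝ} {ξ : Fin n → ℝ} :
    u ∈ feasibleControls A B T ξ ↔ u ∈ admissibleControls T ∧
      -∫ t in (0 : ℝ)..T, u t • (NormedSpace.exp (-(t • A)) *ᵥ B) = ξ := by
  refine and_congr_right fun hu => ?_
  rw [exists_isTrajectory_to_zero_iff hT (intervalIntegrable_of_mem_admissibleControls hT hu),
    neg_eq_iff_add_eq_zero, add_comm]

/-- Cost and feasibility depend only on the a.e. class of the control, so functions may be replaced
by elements of L². -/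
theorem image_soavCost_feasibleControls {N : ℕ} (U w : Fin N → ℝ) (hT : 0 ≤ T) (ξ : Fin n → ℝ) :
    soavCost U w T '' feasibleControls A B T ξ =
      (fun u : ControlSpace T => soavCost U w T u) ''
        (boundedControls T ∩ steeringMap A B T ⁻¹' {ξ}) := by
  ext c
  constructor
  · rintro ⟨u, hu, rfl⟩
    obtain ⟨hu, hξ⟩ := (mem_feasibleControls_iff hT).1 hu
    refine ⟨_, ⟨toLp_mem_boundedControls hu, (steeringMap_toLp hT hu).trans hξ⟩, ?_⟩
    exact soavCost_congr hT (memLp_of_mem_admissibleControls hu 2).coeFn_toLp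
  · rintro ⟨u, ⟨hu, hξ⟩, rfl⟩
    refine ⟨u, (mem_feasibleControls_iff hT).2 ⟨coeFn_mem_admissibleControls hu, ?_⟩, rfl⟩
    rw [intervalIntegral_eq_integral_horizon hT, ← steeringMap_apply]
    exact hξ

end SteeringMap

/-! ### Controllability and bang-bang controls -/

section Controllability

variable {n : ℕ} {A : Matrix (Fin n) (Fin n) ℝ} {B : Fin n → ℝ} {T : ℝ}

/-- Were f(e^{-tA}B) identically zero, applying f to the variation of constants formula for a
control steering v to 0 would give f(v) = 0, for every v. -/
theorem Controllable.exists_apply_ne_zero (hAB : Controllable A B) {f : (Fin n → ℝ) →L[ℝ] ℝ}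
    (hf : f ≠ 0) : ∃ t : ℝ, f (NormedSpace.exp (-(t • A)) *ᵥ B) ≠ 0 := by
  by_contra! hcon
  refine hf (ContinuousLinearMap.ext fun v => ?_)
  obtain ⟨τ, hτ, u, x, hx, rfl, hxτ⟩ := hAB v 0
  have hint : IntervalIntegrable (fun s => u s • (NormedSpace.exp (-(s • A)) *ᵥ B)) volume 0 τ :=
    hx.1.smul_continuousOn (continuous_exp_neg_mulVec A continuous_const).continuousOn
  have h := congrArg f (hx.exp_neg_mulVec_eq hτ.le)
  rw [hxτ, Matrix.mulVec_zero, map_zero, map_add, ← f.intervalIntegral_comp_comm hint] at h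
  simpa [hcon] using h.symm

/-- For a controllable pair, a nonzero linear functional of `e^{-tA} B` vanishes almost nowhere. -/
theorem Controllable.ae_apply_ne_zero (hAB : Controllable A B) {f : (Fin n → ℝ) →L[ℝ] ℝ}
    (hf : f ≠ 0) : ∀ᵐ t : ℝ, f (NormedSpace.exp (-(t • A)) *ᵥ B) ≠ 0 := by
  -- Controllability gives a nonzero value at some time, possibly outside [0, T]; analyticity makes
  -- the zero set discrete, hence null.
  have han : AnalyticOnNhd ℝ (fun t : ℝ => f (NormedSpace.exp (-(t • A)) *ᵥ B)) univ := by
    intro t _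
    refine (f.analyticAt _).fun_comp (AnalyticAt.pi fun i => ?_)
    simp only [Matrix.mulVec, dotProduct]
    exact Finset.univ.analyticAt_fun_sum fun j _ =>
      (analyticOnNhd_matrix_exp_entry A i j t trivial).mul analyticAt_const
  obtain ⟨t₀, ht₀⟩ := hAB.exists_apply_ne_zero hf
  have h := ae_restrict_le_codiscreteWithin (μ := (volume : Measure ℝ)) MeasurableSet.univ
    (han.preimage_zero_mem_codiscrete ht₀)
  rwa [Measure.restrict_univ] at h

/-- The bang-bang control `t ↦ -sign (f (e^{-tA} B))`. -/
noncomputable def bangBang (A : Matrix (Fin n) (Fin n) ℝ) (B : Fin n → ℝ) (f : (Fin n → ℝ) →L[ℝ] ℝ)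
    (t : ℝ) : ℝ :=
  if 0 ≤ f (NormedSpace.exp (-(t • A)) *ᵥ B) then -1 else 1

theorem continuous_apply_exp_neg_mulVec (A : Matrix (Fin n) (Fin n) ℝ) (B : Fin n → ℝ)
    (f : (Fin n → ℝ) →L[ℝ] ℝ) :
    Continuous fun t : ℝ => f (NormedSpace.exp (-(t • A)) *ᵥ B) :=
  f.continuous.comp (continuous_exp_neg_mulVec A continuous_const)

theorem bangBang_mem_admissibleControls (A : Matrix (Fin n) (Fin n) ℝ) (B : Fin n → ℝ) (T : ℝ)
    (f : (Fin n → ℝ) →L[ℝ] ℝ) : bangBang A B f ∈ admissibleControls T := by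
  refine mem_admissibleControls_of_ae_abs_le_one ?_ (Filter.Eventually.of_forall fun t => ?_)
  · exact (Measurable.ite (measurableSet_le measurable_const
      (continuous_apply_exp_neg_mulVec A B f).measurable) measurable_const
      measurable_const).aestronglyMeasurable
  · unfold bangBang
    split_ifs <;> simp

theorem bangBang_mul (f : (Fin n → ℝ) →L[ℝ] ℝ) (t : ℝ) :
    bangBang A B f t * f (NormedSpace.exp (-(t • A)) *ᵥ B) =
      -|f (NormedSpace.exp (-(t • A)) *ᵥ B)| := by
  unfold bangBang
  split_ifs with h
  · rw [abs_of_nonneg h, neg_one_mul]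
  · rw [abs_of_neg (not_le.1 h), one_mul, neg_neg]

/-- The bang-bang control attains the largest value of f on the reachable set. -/
theorem exists_apply_steeringMap_eq_integral_abs (A : Matrix (Fin n) (Fin n) ℝ) (B : Fin n → ℝ)
    (T : ℝ) (f : (Fin n → ℝ) →L[ℝ] ℝ) :
    ∃ v ∈ boundedControls T, f (steeringMap A B T v) =
      ∫ t, |f (NormedSpace.exp (-(t • A)) *ᵥ B)| ∂horizonMeasure T := by
  have hv := bangBang_mem_admissibleControls A B T f
  refine ⟨_, toLp_mem_boundedControls hv, ?_⟩
  rw [apply_steeringMap, ← integral_neg]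
  refine integral_congr_ae ?_
  filter_upwards [(memLp_of_mem_admissibleControls hv 2).coeFn_toLp] with t ht
  rw [ht, bangBang_mul, neg_neg]

theorem integrable_abs_apply_exp_neg_mulVec (A : Matrix (Fin n) (Fin n) ℝ) (B : Fin n → ℝ)
    (T : ℝ) (f : (Fin n → ℝ) →L[ℝ] ℝ) :
    Integrable (fun t : ℝ => |f (NormedSpace.exp (-(t • A)) *ᵥ B)|) (horizonMeasure T) :=
  (continuous_apply_exp_neg_mulVec A B f).abs.continuousOn.integrableOn_Icc

/-- Otherwise this convex set, which contains 0, is killed by some nonzero f. The bang-bang control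
for f then gives ∫ |f(e^{-tA}B)| = 0, contradicting a.e. nonvanishing. Nonempty interior ensures
supporting functionals at non-interior points. -/
theorem Controllable.interior_image_steeringMap_nonempty (hAB : Controllable A B) (hT : 0 < T) :
    (interior (steeringMap A B T '' boundedControls T)).Nonempty := by
  have hcv : Convex ℝ (steeringMap A B T '' boundedControls T) :=
    (convex_boundedControls T).linear_image (steeringMap A B T : ControlSpace T →ₗ[ℝ] Fin n → ℝ)
  have h0 : (0 : Fin n → ℝ) ∈ steeringMap A B T '' boundedControls T := by
    refine ⟨0, ?_, map_zero _⟩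
    filter_upwards [Lp.coeFn_zero ℝ 2 (horizonMeasure T)] with t ht
    rw [ht, Pi.zero_apply, abs_zero]
    exact zero_le_one
  rw [hcv.interior_nonempty_iff_affineSpan_eq_top,
    AffineSubspace.affineSpan_eq_top_iff_vectorSpan_eq_top_of_nonempty ℝ _ _ ⟨0, h0⟩,
    vectorSpan_eq_span_vsub_set_right ℝ h0]
  by_contra hne
  obtain ⟨f, hf, hker⟩ := Submodule.exists_le_ker_of_lt_top _ (lt_top_iff_ne_top.2 hne)
  have hfc : LinearMap.toContinuousLinearMap f ≠ 0 := by
    simpa using hf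
  obtain ⟨v, hv, hfv⟩ :=
    exists_apply_steeringMap_eq_integral_abs A B T (LinearMap.toContinuousLinearMap f)
  have hfv0 : f (steeringMap A B T v) = 0 :=
    hker (Submodule.subset_span ⟨_, ⟨v, hv, rfl⟩, by simp⟩)
  rw [LinearMap.coe_toContinuousLinearMap', hfv0] at hfv
  have hae := (integral_eq_zero_iff_of_nonneg (fun _ => abs_nonneg _)
    (integrable_abs_apply_exp_neg_mulVec A B T (LinearMap.toContinuousLinearMap f))).1 hfv.symm
  have hne : ∀ᵐ t ∂horizonMeasure T, False := by
    filter_upwards [hae, ae_restrict_of_ae (s := Icc 0 T) (hAB.ae_apply_ne_zero hfc)] with t h1 h2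
    exact h2 (abs_eq_zero.1 h1)
  rw [Filter.eventually_false_iff_eq_bot, ae_eq_bot, Measure.restrict_eq_zero, Real.volume_Icc,
    sub_zero, ENNReal.ofReal_eq_zero] at hne
  exact hne.not_gt hT

/-- A control reaching a non-interior point of the reachable set is bang-bang. -/
theorem Controllable.ae_abs_eq_one_of_notMem_interior (hAB : Controllable A B) (hT : 0 < T)
    {u : ControlSpace T} (hu : u ∈ boundedControls T)
    (hint : steeringMap A B T u ∉ interior (steeringMap A B T '' boundedControls T)) :
    ∀ᵐ t ∂horizonMeasure T, |u t| = 1 := by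
  have hcv : Convex ℝ (steeringMap A B T '' boundedControls T) :=
    (convex_boundedControls T).linear_image (steeringMap A B T : ControlSpace T →ₗ[ℝ] Fin n → ℝ)
  obtain ⟨f, hf, hfmax⟩ := geometric_hahn_banach_of_nonempty_interior_point hcv hint
    (hAB.interior_image_steeringMap_nonempty hT)
  obtain ⟨v, hv, hfv⟩ := exists_apply_steeringMap_eq_integral_abs A B T f
  have hle := hfmax _ ⟨v, hv, rfl⟩
  have hi1 := integrable_abs_apply_exp_neg_mulVec A B T f
  have hi2 : Integrable (fun t => u t * f (NormedSpace.exp (-(t • A)) *ᵥ B)) (horizonMeasure T) := by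
    simpa using f.integrable_comp (integrable_smul_exp_neg_mulVec A B u)
  have hnonneg : 0 ≤ᵐ[horizonMeasure T] fun t => |f (NormedSpace.exp (-(t • A)) *ᵥ B)| +
      u t * f (NormedSpace.exp (-(t • A)) *ᵥ B) := by
    filter_upwards [hu] with t ht
    have h1 := neg_abs_le (u t * f (NormedSpace.exp (-(t • A)) *ᵥ B))
    rw [abs_mul] at h1
    have h2 := mul_le_mul_of_nonneg_right ht (abs_nonneg (f (NormedSpace.exp (-(t • A)) *ᵥ B)))
    simp only [Pi.zero_apply]
    linarith
  -- The supporting property, tested on the bang-bang control, says this integral is at most 0,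
  -- while its integrand is nonnegative because |u| ≤ 1.
  have hzero : ∫ t, |f (NormedSpace.exp (-(t • A)) *ᵥ B)| +
      u t * f (NormedSpace.exp (-(t • A)) *ᵥ B) ∂horizonMeasure T = 0 := by
    refine le_antisymm ?_ (integral_nonneg_of_ae hnonneg)
    rw [integral_add hi1 hi2]
    rw [hfv, apply_steeringMap] at hle
    linarith
  have hae := (integral_eq_zero_iff_of_nonneg_ae hnonneg (hi1.add hi2)).1 hzero
  filter_upwards [hae, ae_restrict_of_ae (s := Icc 0 T) (hAB.ae_apply_ne_zero hf)] with t h1 h2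
  have h3 : u t * f (NormedSpace.exp (-(t • A)) *ᵥ B) =
      -|f (NormedSpace.exp (-(t • A)) *ᵥ B)| := by
    simp only [Pi.zero_apply] at h1
    linarith
  have h4 := congrArg abs h3
  rw [abs_mul, abs_neg, abs_abs] at h4
  exact mul_right_cancel₀ (abs_ne_zero.2 h2) (h4.trans (one_mul _).symm)

end Controllability

/-! ### The main theorem -/

theorem theorem5 {n : ℕ} (A : Matrix (Fin n) (Fin n) ℝ) (B : Fin n → ℝ)
    (T : ℝ) (hT : 0 < T)
    {N : ℕ} (hN : 0 < N) (U w : Fin N → ℝ)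
    (hU_mono : StrictMono U) (hU_nonneg : 0 ≤ U ⟨0, hN⟩)
    (hU_last : U ⟨N - 1, Nat.sub_lt hN Nat.one_pos⟩ = 1)
    (hw_nonneg : ∀ i, 0 ≤ w i) (hw_sum : ∑ i, w i = 1)
    (hAB : Controllable A B) :
    (∀ ξ ∈ reachableSet A B T,
      IsLeast (soavCost U w T '' feasibleControls A B T ξ) (valueFunction A B U w T ξ)) ∧
    ContinuousOn (valueFunction A B U w T) (reachableSet A B T) := by
  have hU : ∀ i, U i ∈ Icc (0 : ℝ) 1 := fun i => by
    refine ⟨hU_nonneg.trans (hU_mono.monotone (Fin.mk_le_of_le_val (Nat.zero_le _))), ?_⟩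
    rw [← hU_last]
    exact hU_mono.monotone (Fin.le_def.2 (Nat.le_sub_one_of_lt i.2))
  have hV : valueFunction A B U w T = fun ξ => sInf ((fun u : ControlSpace T => soavCost U w T u) ''
      (boundedControls T ∩ steeringMap A B T ⁻¹' {ξ})) := funext fun ξ => by
    rw [valueFunction, image_soavCost_feasibleControls U w hT.le]
  rw [hV, reachableSet_eq_image hT.le]
  refine ⟨fun ξ hξ => ?_, ?_⟩
  · rw [image_soavCost_feasibleControls U w hT.le]
    exact isLeast_convexProgram (isClosed_boundedControls T) (convex_boundedControls T)
      (isBounded_boundedControls T) (continuous_soavCost hT.le) (convexOn_soavCost hT.le hw_nonneg)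
      (fun u => soavCost_nonneg hT.le hw_nonneg u) hξ
  · exact continuousOn_value_convexProgram (isClosed_boundedControls T) (convex_boundedControls T)
      (isBounded_boundedControls T) (continuous_soavCost hT.le) (convexOn_soavCost hT.le hw_nonneg)
      (fun u => soavCost_nonneg hT.le hw_nonneg u) (T * 2)
      (fun u hu => soavCost_le hT.le hw_nonneg hw_sum hU hu)
      (fun u hu hint => soavCost_eq_of_ae_abs_eq_one hT.le hw_sum hU
        (hAB.ae_abs_eq_one_of_notMem_interior hT hu hint))
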